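/- There is a function $\mathcal T:(1/2,1)\to(0,\infty)$, $s\mapsto \mathcal T_s$ (so $\mathcal T_s$ depends on $s$ only), such that the following holds. For every $1/2<s<1$, every open simply connected set $\Omega\subset\mathbb R^2$ (nonempty, path connected, and such that every loop in $\Omega$ is null-homotopic in $\Omega$), every $r>0$ and every $x_0\in\partial\Omega$, \[ \frac{\mathcal T_s}{r^{2s}}\int_{B_r(x_0)}|u(x)|^2\,dx\;\le\;\iint_{B_r(x_0)\times\mathbb R^2}\frac{|u(x)-u(y)|^2}{|x-y|^{2+2s}}\,dx\,dy \qquad\text{for every } u\in C^\infty_c(\Omega), \] where $B_r(x_0)$ is the open disk of radius $r$ centred at $x_0$ and $C_c^\infty(\Omega)$ is the set of real-valued smooth functions on $\mathbb R^2$ whose support is compact and contained in $\Omega$. Moreover, $\mathcal T_s\sim (s-\tfrac12)$ as $s\searrow \tfrac12$ and $\mathcal T_s\sim \tfrac1{1-s}$ as $s\nearrow 1$, in the sense that the limits \[ \lim_{s\searrow 1/2}\frac{\mathcal T_s}{s-\frac12}\qquad\text{and}\qquad \lim_{s\nearrow 1}\,(1-s)\,\mathcal T_s \] exist and are finite and strictly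 positive. -/

import Mathlib

open MeasureTheory Filter Topology Metric
open scoped ENNReal ContDiff

/-- The nonlocal (Gagliardo) energy
`∬_{A × B} |u(x) - u(y)|² / |x - y|^{2 + 2s} dx dy ∈ [0, ∞]` in the plane. -/
noncomputable def gagliardoEnergy (s : ℝ) (u : EuclideanSpace ℝ (Fin 2) → ℝ)
    (A B : Set (EuclideanSpace ℝ (Fin 2))) : ℝ≥0∞ :=
  ∫⁻ p in A ×ˢ B, ENNReal.ofReal (|u p.1 - u p.2| ^ 2 / ‖p.1 - p.2‖ ^ (2 + 2 * s))
    ∂((volume : Measure (EuclideanSpace ℝ (Fin 2))).prod volume)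

/-! Since `x₀ ∉ Ω`, simple connectedness gives a continuous logarithm of `y - x₀` on `Ω`, so no
circle about `x₀` lies in `Ω` and `u` has a zero on each of them
(`exists_dist_eq_notMem_of_isSimplyConnected`). The rest is a Poincaré inequality on the disk for
continuous functions with this property.

For `x` on the circle of radius `ρ`, compare `u x` with the mean of `u` over the disk of radius `ρ`
by telescoping through disks shrinking to `x` (`enorm_sub_average_sq_le`). Convergence needs `s >
1/2` and costs `1 / (s - 1/2)`. The resulting kernel sees `x` only through `ρ`, so the same bound
serves the zero on that circle, and `u x` itself is controlled. Integrating in `x` only requires a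
radial integral of the kernel, which returns the Gagliardo kernel times `r ^ (2 * s)`
(`setLIntegral_kernel_le`).

The factor `1 - s` comes from comparing scales. Inserting midpoints shows that the normalized energy
at distance about `h` does not decrease when `h` is halved (`annularEnergy_le_half`). Gagliardo
energies are, up to constants, geometric sums of these monotone quantities with ratio `2 ^ (-(2 - 2
* s))`. The order `3/4` energy is therefore at most a multiple of `1 - s` times the order `s` energy
(`setLIntegral_three_quarters_le`), and for `s` near 1 the inequality at order `3/4` suffices. -/

/-! ### Topology: circles about a point outside a simply connected open set. -/

/-- A simply connected open set of the plane that omits `x₀` contains no circle centred at `x₀`. -/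
theorem exists_dist_eq_notMem_of_isSimplyConnected {Ω : Set (EuclideanSpace ℝ (Fin 2))}
    (ho : IsOpen Ω) (hs : IsSimplyConnected Ω) {x₀ : EuclideanSpace ℝ (Fin 2)} (hx₀ : x₀ ∉ Ω)
    {ρ : ℝ} (hρ : 0 < ρ) : ∃ y, dist y x₀ = ρ ∧ y ∉ Ω := by
  by_contra! hcon
  set φ := Complex.orthonormalBasisOneI.repr with hφ
  obtain ⟨L, hLc, hL⟩ := Complex.exists_continuousOn_eqOn_exp_comp hs ho
    (g := fun y => φ.symm (y - x₀)) (by fun_prop) (by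
      rintro ⟨y, hy, h⟩
      have : y - x₀ = 0 := φ.symm.map_eq_zero_iff.1 h
      exact hx₀ (by rwa [← sub_eq_zero.1 this]))
  set γ : ℝ → EuclideanSpace ℝ (Fin 2) := fun t => x₀ + φ (ρ * Complex.exp (t * Complex.I)) with hγ
  have hγΩ : ∀ t, γ t ∈ Ω := fun t => hcon _ (by
    simp [hγ, Complex.norm_exp_ofReal_mul_I, abs_of_pos hρ])
  have hγc : Continuous γ := by fun_prop
  -- This function is continuous with values in `2πiℤ`, hence constant; but over one period `γ`
  -- returns to its start while `t * I` grows by `2πi`.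
  have hc : Continuous fun t => L (γ t) - t * Complex.I - Real.log ρ := by
    have : Continuous fun t => L (γ t) := hLc.comp_continuous hγc hγΩ
    exact (this.sub (by fun_prop)).sub continuous_const
  have hexp : ∀ t, Complex.exp (L (γ t) - t * Complex.I - Real.log ρ) = 1 := by
    intro t
    have h1 : Complex.exp (L (γ t)) = ρ * Complex.exp (t * Complex.I) := by
      have := hL (hγΩ t)
      simpa [hγ] using this
    rw [Complex.exp_sub, Complex.exp_sub, h1, ← Complex.ofReal_exp, Real.exp_log hρ]
    have : (ρ : ℂ) ≠ 0 := by exact_mod_cast hρ.ne'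
    field_simp
  have hint : ∀ t, ∃ n : ℤ, (L (γ t) - t * Complex.I - Real.log ρ).im / (2 * Real.pi) = n := by
    intro t
    obtain ⟨n, hn⟩ := Complex.exp_eq_one_iff.1 (hexp t)
    refine ⟨n, ?_⟩
    rw [hn]
    simp
  choose n hn using hint
  have hnc : Continuous n := by
    rw [Int.isClosedEmbedding_coe_real.isEmbedding.continuous_iff]
    have : ((fun n : ℤ => (n : ℝ)) ∘ n) =
        fun t : ℝ => (L (γ t) - t * Complex.I - Real.log ρ).im / (2 * Real.pi) := by
      ext t; exact (hn t).symm
    change Continuous ((fun n : ℤ => (n : ℝ)) ∘ n)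
    rw [this]
    exact (Complex.continuous_im.comp hc).div_const _
  have h0 : n (2 * Real.pi) = n 0 := PreconnectedSpace.constant inferInstance hnc
  have h1 := hn (2 * Real.pi)
  have h2 := hn 0
  have h3 : γ (2 * Real.pi) = γ 0 := by simp [hγ]
  rw [h0, ← h2, h3] at h1
  have hpi := Real.pi_pos
  field_simp at h1
  simp at h1

/-! ### Cauchy-Schwarz and Jensen inequalities, geometric series. -/

theorem sq_lintegral_mul_le {α : Type*} [MeasurableSpace α] {μ : Measure α} {f g : α → ℝ≥0∞}
    (hf : AEMeasurable f μ) (hg : AEMeasurable g μ) :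
    (∫⁻ a, f a * g a ∂μ) ^ 2 ≤ (∫⁻ a, f a ^ 2 ∂μ) * ∫⁻ a, g a ^ 2 ∂μ := by
  have h := ENNReal.lintegral_mul_le_Lp_mul_Lq μ Real.HolderConjugate.two_two hf hg
  simp only [Pi.mul_apply, ENNReal.rpow_two] at h
  calc _ ≤ ((∫⁻ a, f a ^ 2 ∂μ) ^ (1 / 2 : ℝ) * (∫⁻ a, g a ^ 2 ∂μ) ^ (1 / 2 : ℝ)) ^ 2 := by gcongr
    _ = _ := by
      rw [mul_pow, ← ENNReal.rpow_two, ← ENNReal.rpow_two, ← ENNReal.rpow_mul, ← ENNReal.rpow_mul]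
      norm_num

theorem sq_tsum_mul_le (a b : ℕ → ℝ≥0∞) :
    (∑' k, a k * b k) ^ 2 ≤ (∑' k, a k ^ 2) * ∑' k, b k ^ 2 := by
  simpa [lintegral_count] using sq_lintegral_mul_le (μ := Measure.count)
    (measurable_of_countable a).aemeasurable (measurable_of_countable b).aemeasurable

theorem enorm_integral_sq_le {α : Type*} [MeasurableSpace α] {μ : Measure α}
    [IsProbabilityMeasure μ] {f : α → ℝ} (hf : AEStronglyMeasurable f μ) :
    ‖∫ a, f a ∂μ‖ₑ ^ 2 ≤ ∫⁻ a, ‖f a‖ₑ ^ 2 ∂μ := by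
  calc _ ≤ (∫⁻ a, ‖f a‖ₑ * 1 ∂μ) ^ 2 := by
        gcongr; simpa using enorm_integral_le_lintegral_enorm f
    _ ≤ _ := by
      simpa using sq_lintegral_mul_le (μ := μ) hf.enorm (aemeasurable_const (b := 1))

/-- Jensen's inequality for the difference of the averages of a function over two sets. -/
theorem enorm_average_sub_average_sq_le {α : Type*} [MeasurableSpace α] {μ : Measure α} [SFinite μ]
    {f : α → ℝ} {A B : Set α} (hA : μ A ≠ 0) (hA' : μ A ≠ ⊤) (hB : μ B ≠ 0) (hB' : μ B ≠ ⊤)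
    (hfA : IntegrableOn f A μ) (hfB : IntegrableOn f B μ) :
    ‖(⨍ x in A, f x ∂μ) - ⨍ x in B, f x ∂μ‖ₑ ^ 2 ≤
      (μ A)⁻¹ * (μ B)⁻¹ * ∫⁻ p in A ×ˢ B, ‖f p.1 - f p.2‖ₑ ^ 2 ∂(μ.prod μ) := by
  have e1 : (μ.restrict A) Set.univ = μ A := by simp
  have e2 : (μ.restrict B) Set.univ = μ B := by simp
  set ν₁ := (μ A)⁻¹ • μ.restrict A with hν₁
  set ν₂ := (μ B)⁻¹ • μ.restrict B with hν₂
  have : IsProbabilityMeasure ν₁ := ⟨by simp [hν₁, ENNReal.inv_mul_cancel hA hA']⟩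
  have : IsProbabilityMeasure ν₂ := ⟨by simp [hν₂, ENNReal.inv_mul_cancel hB hB']⟩
  have i1 : Integrable f ν₁ := hfA.smul_measure (by simpa using hA)
  have i2 : Integrable f ν₂ := hfB.smul_measure (by simpa using hB)
  have j1 : Integrable (fun p : α × α => f p.1) (ν₁.prod ν₂) := i1.comp_fst ν₂
  have j2 : Integrable (fun p : α × α => f p.2) (ν₁.prod ν₂) := i2.comp_snd ν₁
  have key : (⨍ x in A, f x ∂μ) - ⨍ x in B, f x ∂μ = ∫ p, (f p.1 - f p.2) ∂(ν₁.prod ν₂) := by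
    rw [integral_sub j1 j2, integral_fun_fst (μ := ν₁) (ν := ν₂) f,
      integral_fun_snd (μ := ν₁) (ν := ν₂) f, average_eq', average_eq', e1, e2]
    simp [hν₁, hν₂]
  rw [key]
  refine (enorm_integral_sq_le (j1.sub j2).aestronglyMeasurable).trans_eq ?_
  rw [hν₁, hν₂, Measure.prod_smul_left, Measure.prod_smul_right, Measure.prod_restrict,
    lintegral_smul_measure, lintegral_smul_measure, smul_eq_mul, smul_eq_mul, mul_assoc]
  rfl

/-- Partial sums of a geometric series of ratio at least two are comparable to the last term. -/
theorem tsum_two_pow_rpow_le {a : ℝ} (ha : 1 ≤ a) {X : ℝ} :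
    ∑' k : ℕ, (if (2 : ℝ) ^ k ≤ X then ENNReal.ofReal (((2 : ℝ) ^ k) ^ a) else 0) ≤
      ENNReal.ofReal (2 * X ^ a) := by
  rcases lt_or_ge X 1 with hX | hX
  · have : ∀ k : ℕ, ¬ ((2 : ℝ) ^ k ≤ X) := fun k h =>
      absurd ((one_le_pow₀ (by norm_num : (1 : ℝ) ≤ 2)).trans h) (by linarith)
    simp [this]
  obtain ⟨N, hN, hN'⟩ := exists_nat_pow_near hX (by norm_num : (1 : ℝ) < 2)
  have hb : (2 : ℝ) ≤ 2 ^ a := by simpa using Real.rpow_le_rpow_of_exponent_le (by norm_num : (1 : ℝ) ≤ 2) ha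
  have hpow : ∀ k : ℕ, ((2 : ℝ) ^ k) ^ a = ((2 : ℝ) ^ a) ^ k := fun k => by
    rw [← Real.rpow_natCast_mul (by norm_num), mul_comm, Real.rpow_mul_natCast (by norm_num)]
  have hsum : ∀ N : ℕ, ∑ k ∈ Finset.range (N + 1), ((2 : ℝ) ^ a) ^ k ≤ 2 * (2 ^ a) ^ N := by
    intro N
    induction N with
    | zero => simp
    | succ N ih =>
      rw [Finset.sum_range_succ, pow_succ (n := N)]
      nlinarith [pow_pos (by linarith : (0 : ℝ) < 2 ^ a) N]
  rw [tsum_eq_sum (s := Finset.range (N + 1))]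
  · calc _ ≤ ∑ k ∈ Finset.range (N + 1), ENNReal.ofReal (((2 : ℝ) ^ a) ^ k) := by
          gcongr with k
          split_ifs
          · rw [hpow]
          · simp
      _ = ENNReal.ofReal (∑ k ∈ Finset.range (N + 1), ((2 : ℝ) ^ a) ^ k) := by
          rw [ENNReal.ofReal_sum_of_nonneg]; intros; positivity
      _ ≤ _ := by
          apply ENNReal.ofReal_le_ofReal
          refine (hsum N).trans ?_
          rw [← hpow]
          gcongr
  · intro k hk
    rw [if_neg]
    rw [Finset.mem_range, not_lt] at hk
    have := pow_le_pow_right₀ (by norm_num : (1 : ℝ) ≤ 2) hk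
    linarith

/-- Weighted Cauchy-Schwarz inequality for a series, with geometric weights. -/
theorem sq_tsum_le_geometric {ε : ℝ} (hε : 0 < ε) (hε' : ε ≤ 1 / 2) (a : ℕ → ℝ≥0∞) :
    (∑' k, a k) ^ 2 ≤
      ENNReal.ofReal (1 / ε) * ∑' k : ℕ, ENNReal.ofReal (((2 : ℝ) ^ k) ^ (2 * ε)) * a k ^ 2 := by
  set p : ℝ := 2 ^ (-ε) with hp
  have hp0 : 0 < p := by positivity
  have hpow : ∀ k : ℕ, ((2 : ℝ) ^ k) ^ (2 * ε) = ((p⁻¹) ^ k) ^ 2 := by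
    intro k
    rw [hp, Real.rpow_neg (by norm_num), inv_inv, ← pow_mul, ← Real.rpow_mul_natCast (by norm_num),
      ← Real.rpow_natCast_mul (by norm_num)]
    congr 1
    push_cast; ring
  have h := sq_tsum_mul_le (fun k => ENNReal.ofReal (p ^ k))
    (fun k => ENNReal.ofReal ((p⁻¹) ^ k) * a k)
  have h1 : ∀ k, ENNReal.ofReal (p ^ k) * (ENNReal.ofReal ((p⁻¹) ^ k) * a k) = a k := by
    intro k
    rw [← mul_assoc, ← ENNReal.ofReal_mul (by positivity), ← mul_pow, mul_inv_cancel₀ hp0.ne']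
    simp
  -- Bernoulli for the concave power: `p ^ 2 = (1 - 1/2) ^ (2 * ε) ≤ 1 - ε`, so the series of `p ^
  -- (2 * k)` is at most `1 / ε`. This is where `2 * ε ≤ 1` is needed.
  have hp2 : p ^ 2 ≤ 1 - ε := by
    rw [hp, ← Real.rpow_mul_natCast (by norm_num)]
    have hb := rpow_one_add_le_one_add_mul_self (s := -1 / 2) (by norm_num) (p := 2 * ε)
      (by linarith) (by linarith)
    have he : (2 : ℝ) ^ (-ε * (2 : ℕ)) = (1 + -1 / 2) ^ (2 * ε) := by
      rw [show (1 : ℝ) + -1 / 2 = 2⁻¹ by norm_num, Real.inv_rpow (by norm_num),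
        ← Real.rpow_neg (by norm_num)]
      congr 1
      push_cast; ring
    rw [he]
    linarith
  refine (by simpa only [h1] using h : _ ≤ _).trans ?_
  gcongr ?_ * ?_
  · have : ∀ k : ℕ, ENNReal.ofReal (p ^ k) ^ 2 = ENNReal.ofReal (p ^ 2) ^ k := fun k => by
      rw [← ENNReal.ofReal_pow (by positivity), ← ENNReal.ofReal_pow (by positivity)]
      congr 1; ring
    simp_rw [this]
    rw [ENNReal.tsum_geometric, one_div, ENNReal.ofReal_inv_of_pos hε]
    gcongr
    rw [← ENNReal.ofReal_one, ← ENNReal.ofReal_sub _ (by positivity)]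
    apply ENNReal.ofReal_le_ofReal
    linarith
  · refine (tsum_congr fun k => ?_).le
    rw [mul_pow, hpow, ENNReal.ofReal_pow (p := p⁻¹ ^ k) (by positivity)]

/-! ### Polar coordinates and the radial integral of the kernel. -/

/-- Integration of a radial function in polar coordinates in the plane. -/
theorem lintegral_fun_norm_plane {g : ℝ → ℝ≥0∞} (hg : Measurable g) :
    ∫⁻ x : EuclideanSpace ℝ (Fin 2), g ‖x‖ =
      ENNReal.ofReal (2 * Real.pi) * ∫⁻ t in Set.Ioi (0 : ℝ), ENNReal.ofReal t * g t := by
  let μ : Measure (EuclideanSpace ℝ (Fin 2)) := volume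
  calc ∫⁻ x, g ‖x‖ ∂μ = ∫⁻ x : ({(0)}ᶜ : Set (EuclideanSpace ℝ (Fin 2))), g ‖x.1‖ ∂(μ.comap (↑)) := by
        rw [lintegral_subtype_comap (measurableSet_singleton _).compl (fun x => g ‖x‖),
          restrict_compl_singleton]
    _ = ∫⁻ x, g x.2 ∂μ.toSphere.prod (.volumeIoiPow (Module.finrank ℝ (EuclideanSpace ℝ (Fin 2)) - 1)) := by
        simpa using μ.measurePreserving_homeomorphUnitSphereProd.lintegral_comp_emb
          (Homeomorph.measurableEmbedding _) (g ∘ Subtype.val ∘ Prod.snd)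
    _ = ∫⁻ x : Set.Ioi (0 : ℝ), μ.toSphere Set.univ * g x ∂.volumeIoiPow (Module.finrank ℝ (EuclideanSpace ℝ (Fin 2)) - 1) := by
        rw [lintegral_prod_symm _ (by fun_prop)]
        simp [mul_comm]
    _ = _ := by
        have h1 : μ.toSphere Set.univ = ENNReal.ofReal (2 * Real.pi) := by
          rw [μ.toSphere_apply_univ]
          simp [μ, ENNReal.ofReal_mul]
        rw [lintegral_const_mul _ (by fun_prop), h1, Measure.volumeIoiPow,
          lintegral_withDensity_eq_lintegral_mul _ (by fun_prop) (by fun_prop)]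
        congr 1
        rw [← lintegral_subtype_comap measurableSet_Ioi]
        simp

theorem lintegral_fun_dist_plane {g : ℝ → ℝ≥0∞} (hg : Measurable g) (x₀ : EuclideanSpace ℝ (Fin 2)) :
    ∫⁻ x : EuclideanSpace ℝ (Fin 2), g (dist x x₀) =
      ENNReal.ofReal (2 * Real.pi) * ∫⁻ t in Set.Ioi (0 : ℝ), ENNReal.ofReal t * g t := by
  rw [← lintegral_fun_norm_plane hg]
  simpa [dist_eq_norm] using lintegral_sub_right_eq_self (fun x => g ‖x‖) x₀

/-- Splitting at `t = d`, the constant part and the tail each contribute at most `1 / d ^ a`. -/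
theorem lintegral_Ioi_max_rpow_le {d a : ℝ} (hd : 0 < d) (ha : 1 ≤ a) :
    ∫⁻ t in Set.Ioi (0 : ℝ), ENNReal.ofReal ((max t d ^ (a + 1))⁻¹) ≤
      ENNReal.ofReal (2 / d ^ a) := by
  rw [← Set.Ioc_union_Ioi_eq_Ioi hd.le]
  have hda : 0 < d ^ a := Real.rpow_pos_of_pos hd a
  calc _ ≤ (∫⁻ t in Set.Ioc 0 d, ENNReal.ofReal ((max t d ^ (a + 1))⁻¹)) +
        ∫⁻ t in Set.Ioi d, ENNReal.ofReal ((max t d ^ (a + 1))⁻¹) := lintegral_union_le _ _ _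
    _ ≤ (∫⁻ t in Set.Ioc 0 d, ENNReal.ofReal ((d ^ (a + 1))⁻¹)) +
        ∫⁻ t in Set.Ioi d, ENNReal.ofReal (t ^ (-(a + 1))) := by
        gcongr ?_ + ?_
        · refine setLIntegral_mono (by fun_prop) fun t ht => ?_
          have : (d : ℝ) ≤ max t d := le_max_right _ _
          gcongr
        · refine setLIntegral_mono (by fun_prop) fun t ht => ?_
          rw [Real.rpow_neg (hd.trans ht).le]
          have h1 : (t : ℝ) ≤ max t d := le_max_left _ _
          have h2 : 0 < t := hd.trans ht
          gcongr
    _ ≤ ENNReal.ofReal (1 / d ^ a) + ENNReal.ofReal (1 / d ^ a) := by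
        gcongr ?_ + ?_
        · rw [setLIntegral_const, Real.volume_Ioc, ← ENNReal.ofReal_mul (by positivity)]
          apply ENNReal.ofReal_le_ofReal
          rw [Real.rpow_add_one hd.ne', sub_zero]
          field_simp
          exact le_rfl
        · rw [← ofReal_integral_eq_lintegral_ofReal (integrableOn_Ioi_rpow_of_lt (by linarith) hd)
            ((ae_restrict_mem measurableSet_Ioi).mono fun t ht =>
              Real.rpow_nonneg (hd.trans ht).le _), integral_Ioi_rpow_of_lt (by linarith) hd]
          apply ENNReal.ofReal_le_ofReal
          rw [show -(a + 1) + 1 = -a by ring, Real.rpow_neg hd.le]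
          rw [neg_div_neg_eq, div_le_iff₀ (by linarith), one_div]
          exact le_mul_of_one_le_right (by positivity) ha
    _ = _ := by
        rw [← ENNReal.ofReal_add (by positivity) (by positivity)]
        congr 1; ring

/-- The kernel that the telescoping estimate produces, integrated over the disk. -/
theorem setLIntegral_kernel_le (x₀ : EuclideanSpace ℝ (Fin 2)) {r s a d : ℝ} (hr : 0 < r)
    (hs : 1 / 2 < s) (hd : 0 < d) :
    ∫⁻ x in ball x₀ r, (if a < dist x x₀ then
      ENNReal.ofReal (dist x x₀ ^ (2 * s - 1) / max (dist x x₀ - a) d ^ (2 * s + 3)) else 0) ≤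
      ENNReal.ofReal (4 * Real.pi * r ^ (2 * s) / d ^ (2 * s + 2)) := by
  set g : ℝ → ℝ≥0∞ := fun t => if a < t then
      ENNReal.ofReal (t ^ (2 * s - 1) / max (t - a) d ^ (2 * s + 3)) else 0 with hg
  have hgm : Measurable g := Measurable.ite measurableSet_Ioi (by fun_prop) measurable_const
  rw [← lintegral_indicator measurableSet_ball]
  have e : ∀ x, (ball x₀ r).indicator (fun x => g (dist x x₀)) x =
      (Set.Iio r).indicator g (dist x x₀) := fun x => by simp [Set.indicator]
  calc _ = ∫⁻ x, (Set.Iio r).indicator g (dist x x₀) := lintegral_congr e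
    _ = ENNReal.ofReal (2 * Real.pi) *
        ∫⁻ t in Set.Ioi (0 : ℝ), ENNReal.ofReal t * (Set.Iio r).indicator g t :=
      lintegral_fun_dist_plane (hgm.indicator measurableSet_Iio) x₀
    -- The polar Jacobian `t` turns `t ^ (2 * s - 1)` into `t ^ (2 * s) ≤ r ^ (2 * s)`; what remains
    -- is a translate by `a` of the one-dimensional integral above.
    _ ≤ ENNReal.ofReal (2 * Real.pi) * ∫⁻ t in Set.Ioi (0 : ℝ), (Set.Ioi a).indicator
        (fun t => ENNReal.ofReal (r ^ (2 * s)) * 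
          ENNReal.ofReal ((max (t - a) d ^ ((2 * s + 2) + 1))⁻¹)) t := by
      refine mul_le_mul' le_rfl ?_
      refine setLIntegral_mono' measurableSet_Ioi fun t ht => ?_
      rw [Set.mem_Ioi] at ht
      by_cases h1 : t < r
      · by_cases h2 : a < t
        · simp only [Set.indicator, Set.mem_Iio, Set.mem_Ioi, h1, h2, if_true, hg]
          rw [← ENNReal.ofReal_mul ht.le, ← ENNReal.ofReal_mul (by have := ht.trans h1; positivity)]
          apply ENNReal.ofReal_le_ofReal
          rw [← mul_div_assoc, div_eq_mul_inv, show 2 * s + 2 + 1 = 2 * s + 3 by ring]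
          have : t * t ^ (2 * s - 1) = t ^ (2 * s) := by
            rw [← Real.rpow_one_add' ht.le (by linarith)]; congr 1; ring
          rw [this]
          have : 0 < max (t - a) d := lt_max_of_lt_right hd
          gcongr
        · simp [hg, h2, Set.indicator]
      · simp [Set.indicator, h1]
    _ ≤ ENNReal.ofReal (2 * Real.pi) * (ENNReal.ofReal (r ^ (2 * s)) * 
          ENNReal.ofReal (2 / d ^ (2 * s + 2))) := by
      refine mul_le_mul' le_rfl ?_
      refine (setLIntegral_le_lintegral _ _).trans ?_
      rw [lintegral_indicator measurableSet_Ioi, lintegral_const_mul _ (by fun_prop)]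
      refine mul_le_mul' le_rfl ?_
      refine le_trans (le_of_eq ?_) (lintegral_Ioi_max_rpow_le hd (by linarith : 1 ≤ 2 * s + 2))
      rw [← lintegral_indicator measurableSet_Ioi, ← lintegral_indicator measurableSet_Ioi,
        ← lintegral_sub_right_eq_self ((Set.Ioi (0 : ℝ)).indicator _) a]
      congr 1 with t
      simp [Set.indicator]
    _ = _ := by
      rw [← ENNReal.ofReal_mul (by positivity), ← ENNReal.ofReal_mul (by positivity)]
      congr 1; ring

/-! ### Telescoping over disks shrinking to a point of the circle. -/

/-- The average of a continuous function over shrinking balls close to `x` tends to its value. -/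
theorem tendsto_average_of_subset_closedBall {u : EuclideanSpace ℝ (Fin 2) → ℝ} (hu : Continuous u)
    {x : EuclideanSpace ℝ (Fin 2)} {A : ℕ → Set (EuclideanSpace ℝ (Fin 2))} {δ : ℕ → ℝ}
    (hδ : Tendsto δ atTop (𝓝 0)) (hA : ∀ k, A k ⊆ closedBall x (δ k))
    (hAm : ∀ k, MeasurableSet (A k)) (h0 : ∀ k, volume (A k) ≠ 0) :
    Tendsto (fun k => ⨍ z in A k, u z) atTop (𝓝 (u x)) := by
  rw [Metric.tendsto_atTop]
  intro ε hε
  obtain ⟨η, hη, h⟩ := Metric.continuousAt_iff.1 (hu.continuousAt (x := x)) (ε / 2) (by positivity)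
  obtain ⟨N, hN⟩ := (hδ.eventually_lt_const hη).exists_forall_of_atTop
  refine ⟨N, fun k hk => ?_⟩
  have hint : IntegrableOn u (A k) :=
    (hu.continuousOn.integrableOn_compact (isCompact_closedBall x (δ k))).mono_set (hA k)
  have hfin : volume (A k) ≠ ⊤ :=
    ((measure_mono (hA k)).trans_lt measure_closedBall_lt_top).ne
  have hmem : ∀ᵐ z ∂volume.restrict (A k), u z ∈ closedBall (u x) (ε / 2) := by
    have : ∀ z ∈ A k, u z ∈ closedBall (u x) (ε / 2) := fun z hz =>
      (h (lt_of_le_of_lt (hA k hz) (hN k hk))).le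
    exact ae_restrict_of_forall_mem (hAm k) this
  have := (convex_closedBall (u x) (ε / 2)).set_average_mem isClosed_closedBall (h0 k) hfin hmem hint
  rw [mem_closedBall] at this
  linarith

theorem inv_volume_ball_mul_inv_volume_ball_le {a b : EuclideanSpace ℝ (Fin 2)} {ρ : ℝ} (hρ : 0 < ρ)
    (k : ℕ) :
    (volume (ball a ((1 / 2) ^ k * ρ)))⁻¹ * (volume (ball b ((1 / 2) ^ (k + 1) * ρ)))⁻¹ ≤
      ENNReal.ofReal (16 ^ k / ρ ^ 4) := by
  rw [EuclideanSpace.volume_ball_fin_two, EuclideanSpace.volume_ball_fin_two,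
    ← ENNReal.ofReal_pow (by positivity), ← ENNReal.ofReal_pow (by positivity),
    ← ENNReal.ofReal_mul (by positivity), ← ENNReal.ofReal_mul (by positivity),
    ← ENNReal.ofReal_inv_of_pos (by positivity), ← ENNReal.ofReal_inv_of_pos (by positivity),
    ← ENNReal.ofReal_mul (by positivity)]
  apply ENNReal.ofReal_le_ofReal
  have e : (((1 / 2 : ℝ) ^ k * ρ) ^ 2 * Real.pi)⁻¹ * (((1 / 2) ^ (k + 1) * ρ) ^ 2 * Real.pi)⁻¹ =
      16 ^ k / ρ ^ 4 * (4 / Real.pi ^ 2) := by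
    have : (16 : ℝ) ^ k = (2 ^ k) ^ 4 := by rw [← pow_mul, mul_comm, pow_mul]; norm_num
    rw [this, one_div, inv_pow, inv_pow]
    field_simp
    ring
  rw [e]
  refine mul_le_of_le_one_right (by positivity) ?_
  rw [div_le_one (by positivity)]
  nlinarith [Real.pi_gt_three]

/-- Telescoping estimate: the distance of `u x` to the average of `u` over the disk centred at `x₀`
that has `x` on its boundary. -/
theorem enorm_sub_average_sq_le {u : EuclideanSpace ℝ (Fin 2) → ℝ} (hu : Continuous u)
    {x x₀ : EuclideanSpace ℝ (Fin 2)} {ρ s : ℝ} (hρ : 0 < ρ) (hx : dist x x₀ = ρ)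
    (hs : 1 / 2 < s) (hs' : s < 1) :
    ‖u x - ⨍ z in ball x₀ ρ, u z‖ₑ ^ 2 ≤ ENNReal.ofReal (64 / (s - 1 / 2)) *
      ∫⁻ p in ball x₀ ρ ×ˢ ball x₀ ρ, ENNReal.ofReal
        (ρ ^ (2 * s - 1) / max (ρ - dist p.1 x₀) (dist p.1 p.2) ^ (2 * s + 3)) *
          ‖u p.1 - u p.2‖ₑ ^ 2 ∂(volume.prod volume) := by
  -- The disks `B k` are nested, lie in the disk `B 0` of radius `ρ` about `x₀`, and all have `x` on
  -- their boundary.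
  set c : ℕ → EuclideanSpace ℝ (Fin 2) := fun k => AffineMap.lineMap x x₀ ((1 / 2 : ℝ) ^ k) with hc
  set B : ℕ → Set (EuclideanSpace ℝ (Fin 2)) := fun k => ball (c k) ((1 / 2 : ℝ) ^ k * ρ) with hB
  have hpos : ∀ k : ℕ, (0 : ℝ) < (1 / 2) ^ k := fun k => by positivity
  have hle1 : ∀ k : ℕ, (1 / 2 : ℝ) ^ k ≤ 1 := fun k => pow_le_one₀ (by norm_num) (by norm_num)
  have hcx : ∀ k, dist (c k) x = (1 / 2 : ℝ) ^ k * ρ := fun k => by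
    rw [hc, dist_lineMap_left, Real.norm_of_nonneg (hpos k).le, hx]
  have hcx₀ : ∀ k, dist (c k) x₀ = (1 - (1 / 2 : ℝ) ^ k) * ρ := fun k => by
    rw [hc, dist_lineMap_right, Real.norm_of_nonneg (by linarith [hle1 k]), hx]
  have hBx : ∀ k, ∀ z ∈ B k, dist z x ≤ 2 * (1 / 2 : ℝ) ^ k * ρ := fun k z hz => by
    have := mem_ball.1 hz
    linarith [dist_triangle z (c k) x, hcx k]
  have hBρ : ∀ k, B k ⊆ ball x₀ ρ := fun k => ball_subset_ball' (by rw [hcx₀]; linarith)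
  have hBsucc : ∀ k, B (k + 1) ⊆ B k := fun k => ball_subset_ball' (by
    have : dist (c (k + 1)) (c k) = (1 / 2 : ℝ) ^ (k + 1) * ρ := by
      rw [hc, dist_lineMap_lineMap, hx, Real.dist_eq, pow_succ, abs_sub_comm, abs_of_nonneg]
      · ring
      · linarith [hpos k]
    rw [this, pow_succ]; linarith)
  have hvol : ∀ k, volume (B k) ≠ 0 := fun k =>
    (measure_ball_pos volume _ (mul_pos (hpos k) hρ)).ne'
  have hvol' : ∀ k, volume (B k) ≠ ⊤ := fun k => measure_ball_lt_top.ne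
  have hint : ∀ k, IntegrableOn u (B k) := fun k =>
    (hu.continuousOn.integrableOn_compact (isCompact_closedBall (c k) _)).mono_set
      ball_subset_closedBall
  have hlim : Tendsto (fun k => ⨍ z in B k, u z) atTop (𝓝 (u x)) := by
    refine tendsto_average_of_subset_closedBall hu (δ := fun k => 2 * (1 / 2 : ℝ) ^ k * ρ) ?_
      hBx (fun _ => measurableSet_ball) hvol
    have := (tendsto_pow_atTop_nhds_zero_of_lt_one (r := (1 / 2 : ℝ)) (by norm_num)
      (by norm_num)).const_mul 2 |>.mul_const ρ
    simpa using this
  have hB0 : B 0 = ball x₀ ρ := by simp [hB, hc]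
  set D := ball x₀ ρ ×ˢ ball x₀ ρ with hD
  set M : EuclideanSpace ℝ (Fin 2) × EuclideanSpace ℝ (Fin 2) → ℝ :=
    fun p => max (ρ - dist p.1 x₀) (dist p.1 p.2) with hM
  have hMc : Continuous M := by fun_prop
  set f : EuclideanSpace ℝ (Fin 2) × EuclideanSpace ℝ (Fin 2) → ℝ≥0∞ :=
    fun p => ‖u p.1 - u p.2‖ₑ ^ 2 with hf
  have hfm : Measurable f := by fun_prop
  have hDm : MeasurableSet D := measurableSet_ball.prod measurableSet_ball
  have hstep : ∀ k, ‖(⨍ z in B k, u z) - ⨍ z in B (k + 1), u z‖ₑ ^ 2 ≤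
      ∫⁻ p in D, (if (2 : ℝ) ^ k ≤ 2 * ρ / M p then ENNReal.ofReal (16 ^ k / ρ ^ 4) else 0) * f p
        ∂(volume.prod volume) := by
    intro k
    refine (enorm_average_sub_average_sq_le (hvol k) (hvol' k) (hvol _) (hvol' _) (hint k)
      (hint _)).trans ?_
    refine (mul_le_mul' (inv_volume_ball_mul_inv_volume_ball_le hρ k) le_rfl).trans ?_
    rw [← lintegral_const_mul _ (by fun_prop)]
    refine le_trans (setLIntegral_mono' (measurableSet_ball.prod measurableSet_ball)
      fun p hp => ?_) (lintegral_mono_set (Set.prod_mono (hBρ k) (hBρ (k + 1))))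
    have hp1 := hp.1
    have hp2 := hBsucc k hp.2
    have hM0 : 0 < M p := lt_max_of_lt_left (by linarith [mem_ball.1 (hBρ k hp1)])
    rw [if_pos]
    rw [le_div_iff₀ hM0]
    -- Points of `B k` are within one diameter of `x`, which bounds `ρ - dist p.1 x₀`; both points
    -- lie in `B k`, which bounds their distance. So a pair occurs at step `k` only if `2 ^ k ≤ 2 *
    -- ρ / M p`.
    have hMle : M p ≤ 2 * (1 / 2 : ℝ) ^ k * ρ := by
      refine max_le ?_ ?_
      · linarith [hBx k _ hp1, dist_triangle x p.1 x₀, dist_comm x p.1]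
      · linarith [dist_triangle_right p.1 p.2 (c k), mem_ball.1 hp1, mem_ball.1 hp2]
    calc (2 : ℝ) ^ k * M p ≤ 2 ^ k * (2 * (1 / 2 : ℝ) ^ k * ρ) := by gcongr
      _ = 2 * ρ := by rw [one_div, inv_pow]; field_simp
  have hedist : ‖u x - ⨍ z in ball x₀ ρ, u z‖ₑ ≤
      ∑' k, ‖(⨍ z in B k, u z) - ⨍ z in B (k + 1), u z‖ₑ := by
    have := edist_le_tsum_of_edist_le_of_tendsto₀
      (fun k => ‖(⨍ z in B k, u z) - ⨍ z in B (k + 1), u z‖ₑ)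
      (fun k => (edist_eq_enorm_sub _ _).le) hlim
    rwa [edist_comm, edist_eq_enorm_sub, hB0] at this
  calc _ ≤ (∑' k, ‖(⨍ z in B k, u z) - ⨍ z in B (k + 1), u z‖ₑ) ^ 2 := by gcongr
    _ ≤ ENNReal.ofReal (1 / (s - 1 / 2)) * ∑' k : ℕ,
        ENNReal.ofReal (((2 : ℝ) ^ k) ^ (2 * (s - 1 / 2))) *
          ‖(⨍ z in B k, u z) - ⨍ z in B (k + 1), u z‖ₑ ^ 2 :=
      sq_tsum_le_geometric (by linarith) (by linarith) _
    _ ≤ ENNReal.ofReal (1 / (s - 1 / 2)) * ∑' k : ℕ,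
        ENNReal.ofReal (((2 : ℝ) ^ k) ^ (2 * (s - 1 / 2))) *
          ∫⁻ p in D, (if (2 : ℝ) ^ k ≤ 2 * ρ / M p then ENNReal.ofReal (16 ^ k / ρ ^ 4) else 0) *
            f p ∂(volume.prod volume) := by
      gcongr with k
      exact hstep k
    _ = ENNReal.ofReal (1 / (s - 1 / 2)) * ∫⁻ p in D, ∑' k : ℕ,
        ENNReal.ofReal (((2 : ℝ) ^ k) ^ (2 * (s - 1 / 2))) *
          ((if (2 : ℝ) ^ k ≤ 2 * ρ / M p then ENNReal.ofReal (16 ^ k / ρ ^ 4) else 0) *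
            f p) ∂(volume.prod volume) := by
      have hm : ∀ k : ℕ, Measurable fun p =>
          (if (2 : ℝ) ^ k ≤ 2 * ρ / M p then ENNReal.ofReal (16 ^ k / ρ ^ 4) else 0) * f p :=
        fun k => (Measurable.ite (measurableSet_le measurable_const
          (measurable_const.div hMc.measurable)) measurable_const measurable_const).mul hfm
      rw [lintegral_tsum fun k => ((hm k).const_mul _).aemeasurable]
      congr 2 with k
      rw [lintegral_const_mul _ (hm k)]
    _ ≤ ENNReal.ofReal (1 / (s - 1 / 2)) * ∫⁻ p in D, ENNReal.ofReal 64 *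
        (ENNReal.ofReal (ρ ^ (2 * s - 1) / M p ^ (2 * s + 3)) * f p) ∂(volume.prod volume) := by
      refine mul_le_mul' le_rfl (setLIntegral_mono' hDm fun p hp => ?_)
      have hM0 : 0 < M p := lt_max_of_lt_left (by linarith [mem_ball.1 hp.1])
      simp_rw [← mul_assoc]
      rw [ENNReal.tsum_mul_right]
      refine mul_le_mul' ?_ le_rfl
      -- The inverse areas give `16 ^ k = 2 ^ (4 * k)` and the Cauchy-Schwarz weight gives `2 ^ (k *
      -- (2 * s - 1))`; the truncated series is dominated by its last term.
      calc _ = ENNReal.ofReal (1 / ρ ^ 4) * ∑' k : ℕ, (if (2 : ℝ) ^ k ≤ 2 * ρ / M p then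
            ENNReal.ofReal (((2 : ℝ) ^ k) ^ (2 * s + 3)) else 0) := by
            rw [← ENNReal.tsum_mul_left]
            congr 1 with k
            split_ifs
            · rw [← ENNReal.ofReal_mul (by positivity), ← ENNReal.ofReal_mul (by positivity)]
              congr 1
              have h16 : (16 : ℝ) ^ k = ((2 : ℝ) ^ k) ^ (4 : ℝ) := by
                have : (16 : ℝ) ^ k = (2 ^ k) ^ 4 := by rw [← pow_mul, mul_comm, pow_mul]; norm_num
                rw [this]; norm_cast
              rw [h16, show 2 * s + 3 = 2 * (s - 1 / 2) + 4 by ring,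
                Real.rpow_add (by positivity)]
              ring
            · simp
        _ ≤ ENNReal.ofReal (1 / ρ ^ 4) * ENNReal.ofReal (2 * (2 * ρ / M p) ^ (2 * s + 3)) :=
            mul_le_mul' le_rfl (tsum_two_pow_rpow_le (by linarith))
        _ ≤ _ := by
            rw [← ENNReal.ofReal_mul (by positivity), ← ENNReal.ofReal_mul (by positivity)]
            apply ENNReal.ofReal_le_ofReal
            have h2 : (2 : ℝ) ^ (2 * s + 3) ≤ 32 := by
              calc (2 : ℝ) ^ (2 * s + 3) ≤ 2 ^ (5 : ℝ) :=
                    Real.rpow_le_rpow_of_exponent_le (by norm_num) (by linarith)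
                _ = 32 := by norm_num
            have hρs : ρ ^ (2 * s + 3) = ρ ^ (2 * s - 1) * ρ ^ 4 := by
              rw [show 2 * s + 3 = 2 * s - 1 + (4 : ℕ) by push_cast; ring,
                Real.rpow_add_natCast hρ.ne']
            rw [Real.div_rpow (by positivity) hM0.le, Real.mul_rpow (by norm_num) hρ.le, hρs]
            have hMp : 0 < M p ^ (2 * s + 3) := Real.rpow_pos_of_pos hM0 _
            have hρp : 0 < ρ ^ (2 * s - 1) := Real.rpow_pos_of_pos hρ _
            calc _ = 2 * 2 ^ (2 * s + 3) * (ρ ^ (2 * s - 1) / M p ^ (2 * s + 3)) := by field_simp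
              _ ≤ 2 * 32 * (ρ ^ (2 * s - 1) / M p ^ (2 * s + 3)) := by gcongr
              _ = _ := by ring
    _ = _ := by
      rw [lintegral_const_mul _ (by fun_prop), ← mul_assoc,
        ← ENNReal.ofReal_mul (by have := sub_pos.2 hs; positivity)]
      congr 2
      ring

/-- The kernel depends on `x` only through `ρ`, so `u x` and the zero `u y` are equally close to the
common mean `m`. -/
theorem enorm_sq_le_of_exists_zero {u : EuclideanSpace ℝ (Fin 2) → ℝ} (hu : Continuous u)
    {x x₀ : EuclideanSpace ℝ (Fin 2)} {ρ s : ℝ} (hρ : 0 < ρ) (hx : dist x x₀ = ρ)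
    (hs : 1 / 2 < s) (hs' : s < 1) (h0 : ∃ y, dist y x₀ = ρ ∧ u y = 0) :
    ‖u x‖ₑ ^ 2 ≤ ENNReal.ofReal (256 / (s - 1 / 2)) *
      ∫⁻ p in ball x₀ ρ ×ˢ ball x₀ ρ, ENNReal.ofReal
        (ρ ^ (2 * s - 1) / max (ρ - dist p.1 x₀) (dist p.1 p.2) ^ (2 * s + 3)) *
          ‖u p.1 - u p.2‖ₑ ^ 2 ∂(volume.prod volume) := by
  obtain ⟨y, hy, huy⟩ := h0
  have h1 := enorm_sub_average_sq_le hu hρ hx hs hs'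
  have h2 := enorm_sub_average_sq_le hu hρ hy hs hs'
  set I := ∫⁻ p in ball x₀ ρ ×ˢ ball x₀ ρ, ENNReal.ofReal
        (ρ ^ (2 * s - 1) / max (ρ - dist p.1 x₀) (dist p.1 p.2) ^ (2 * s + 3)) *
          ‖u p.1 - u p.2‖ₑ ^ 2 ∂(volume.prod volume)
  set m := ⨍ z in ball x₀ ρ, u z
  have h3 : ‖u x‖ₑ ^ 2 ≤ 2 * (‖u x - m‖ₑ ^ 2 + ‖u y - m‖ₑ ^ 2) := by
    simp only [Real.enorm_eq_ofReal_abs, ← ENNReal.ofReal_pow (abs_nonneg _), sq_abs]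
    rw [← ENNReal.ofReal_add (by positivity) (by positivity),
      show (2 : ℝ≥0∞) = ENNReal.ofReal 2 by simp, ← ENNReal.ofReal_mul (by norm_num)]
    apply ENNReal.ofReal_le_ofReal
    rw [huy]
    nlinarith [sq_nonneg (u x - 2 * m)]
  calc _ ≤ _ := h3
    _ ≤ 2 * (ENNReal.ofReal (64 / (s - 1 / 2)) * I + ENNReal.ofReal (64 / (s - 1 / 2)) * I) := by
      gcongr
    _ = ENNReal.ofReal 4 * ENNReal.ofReal (64 / (s - 1 / 2)) * I := by
      rw [show ENNReal.ofReal 4 = 4 by simp]; ring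
    _ = _ := by
      rw [← ENNReal.ofReal_mul (by norm_num)]
      congr 2; ring

/-! ### Poincaré inequality with the factor `1 / (s - 1/2)`. -/

/-- Fractional Poincaré inequality on a disk for a function with a zero on every concentric
circle. -/
theorem setLIntegral_enorm_sq_le_of_exists_zero {u : EuclideanSpace ℝ (Fin 2) → ℝ}
    (hu : Continuous u) {x₀ : EuclideanSpace ℝ (Fin 2)} {r s : ℝ} (hr : 0 < r)
    (hs : 1 / 2 < s) (hs' : s < 1) (h0 : ∀ ρ, 0 < ρ → ∃ y, dist y x₀ = ρ ∧ u y = 0) :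
    ∫⁻ x in ball x₀ r, ‖u x‖ₑ ^ 2 ≤ ENNReal.ofReal (4096 / (s - 1 / 2) * r ^ (2 * s)) *
      ∫⁻ p in ball x₀ r ×ˢ ball x₀ r, ENNReal.ofReal (1 / dist p.1 p.2 ^ (2 * s + 2)) *
          ‖u p.1 - u p.2‖ₑ ^ 2 ∂(volume.prod volume) := by
  set K : EuclideanSpace ℝ (Fin 2) → EuclideanSpace ℝ (Fin 2) × EuclideanSpace ℝ (Fin 2) → ℝ≥0∞ :=
    fun x p => if dist p.1 x₀ < dist x x₀ then ENNReal.ofReal (dist x x₀ ^ (2 * s - 1) /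
      max (dist x x₀ - dist p.1 x₀) (dist p.1 p.2) ^ (2 * s + 3)) else 0 with hK
  have hKm : Measurable (Function.uncurry K) := by
    refine Measurable.ite (measurableSet_lt ?_ ?_) ?_ measurable_const <;> fun_prop
  set f : EuclideanSpace ℝ (Fin 2) × EuclideanSpace ℝ (Fin 2) → ℝ≥0∞ :=
    fun p => ‖u p.1 - u p.2‖ₑ ^ 2 with hf
  have hfm : Measurable f := by fun_prop
  set D := ball x₀ r ×ˢ ball x₀ r with hD
  have hDm : MeasurableSet D := measurableSet_ball.prod measurableSet_ball
  have hs0 : 0 < s - 1 / 2 := by linarith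
  calc ∫⁻ x in ball x₀ r, ‖u x‖ₑ ^ 2
      ≤ ∫⁻ x in ball x₀ r, ENNReal.ofReal (256 / (s - 1 / 2)) *
        ∫⁻ p in D, K x p * f p ∂(volume.prod volume) := by
        refine lintegral_mono_ae ?_
        have hne : ∀ᵐ x ∂(volume : Measure (EuclideanSpace ℝ (Fin 2))).restrict (ball x₀ r), x ≠ x₀ :=
          ae_restrict_of_ae (by simp [ae_iff])
        filter_upwards [hne, ae_restrict_mem measurableSet_ball] with x hx hxr
        have hρ : 0 < dist x x₀ := dist_pos.2 hx
        refine (enorm_sq_le_of_exists_zero hu hρ rfl hs hs' (h0 _ hρ)).trans ?_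
        refine mul_le_mul' le_rfl ?_
        have hsub : ball x₀ (dist x x₀) ⊆ ball x₀ r := ball_subset_ball (mem_ball.1 hxr).le
        refine le_trans (setLIntegral_mono' (measurableSet_ball.prod measurableSet_ball)
          fun p hp => ?_) (lintegral_mono_set (Set.prod_mono hsub hsub))
        simp only [hK]
        rw [if_pos (mem_ball.1 hp.1)]
    _ = ENNReal.ofReal (256 / (s - 1 / 2)) * ∫⁻ p in D, (∫⁻ x in ball x₀ r, K x p) * f p
        ∂(volume.prod volume) := by
        have hm : Measurable (Function.uncurry fun x p => K x p * f p) :=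
          hKm.mul (hfm.comp measurable_snd)
        have hmi : Measurable fun x => ∫⁻ p in D, K x p * f p ∂(volume.prod volume) :=
          hm.lintegral_prod_right'
        rw [lintegral_const_mul _ hmi, lintegral_lintegral_swap hm.aemeasurable]
        congr 2 with p
        rw [lintegral_mul_const _ (hKm.of_uncurry_right)]
    _ ≤ ENNReal.ofReal (256 / (s - 1 / 2)) * ∫⁻ p in D, (ENNReal.ofReal (16 * r ^ (2 * s)) *
          ENNReal.ofReal (1 / dist p.1 p.2 ^ (2 * s + 2))) * f p ∂(volume.prod volume) := by
        refine mul_le_mul' le_rfl (setLIntegral_mono' hDm fun p hp => ?_)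
        -- The kernel bound needs a positive distance; on the diagonal the difference of `u`
        -- vanishes.
        rcases eq_or_ne p.1 p.2 with h | h
        · simp [hf, h]
        · refine mul_le_mul' ?_ le_rfl
          refine (setLIntegral_kernel_le x₀ hr hs (dist_pos.2 h)).trans ?_
          rw [← ENNReal.ofReal_mul (by positivity), mul_one_div]
          apply ENNReal.ofReal_le_ofReal
          gcongr
          linarith [Real.pi_lt_four]
    _ = _ := by
        simp_rw [mul_assoc]
        rw [lintegral_const_mul _ (by fun_prop), ← mul_assoc,
          ← ENNReal.ofReal_mul (by positivity)]
        congr 2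
        ring

/-! ### Comparison of energies across scales, giving the factor `1 - s`. -/

theorem lintegral_comp_midpoint {g : EuclideanSpace ℝ (Fin 2) → ℝ≥0∞} (hg : Measurable g)
    (x : EuclideanSpace ℝ (Fin 2)) : ∫⁻ y, g (midpoint ℝ x y) = 4 * ∫⁻ y, g y := by
  have h : ∀ y, midpoint ℝ x y = (1 / 2 : ℝ) • (x + y) := fun y => by
    rw [midpoint_eq_smul_add]; simp
  simp_rw [h]
  rw [lintegral_add_left_eq_self (fun y => g ((1 / 2 : ℝ) • y)) x,
    ← lintegral_map hg (by fun_prop), Measure.map_addHaar_smul _ (by norm_num),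
    lintegral_smul_measure]
  norm_num

/-- The normalized energy of the pairs of points of `S` at distance between `h` and `2 h`. -/
noncomputable def annularEnergy (u : EuclideanSpace ℝ (Fin 2) → ℝ)
    (S : Set (EuclideanSpace ℝ (Fin 2))) (h : ℝ) : ℝ≥0∞ :=
  ∫⁻ p in S ×ˢ S, (if dist p.1 p.2 ∈ Set.Ioc h (2 * h) then
    ENNReal.ofReal ((u p.1 - u p.2) ^ 2 / dist p.1 p.2 ^ 4) else 0) ∂(volume.prod volume)

/-- With `m` the midpoint, `(u x - u y)² ≤ 2 (u x - u m)² + 2 (u y - u m)²`. Halving the distance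
changes its fourth power by 16, which leaves `1/8`; replacing `y` or `x` by `m` costs a Jacobian 4
in each of the two terms, and `(4 + 4) / 8 = 1`. Convexity keeps `m` in `S`. -/
theorem annularEnergy_le_half {u : EuclideanSpace ℝ (Fin 2) → ℝ} (hu : Continuous u)
    {S : Set (EuclideanSpace ℝ (Fin 2))} (hS : Convex ℝ S) (hSm : MeasurableSet S) {h : ℝ}
    (hh : 0 < h) : annularEnergy u S h ≤ annularEnergy u S (h / 2) := by
  set F : ℝ → EuclideanSpace ℝ (Fin 2) × EuclideanSpace ℝ (Fin 2) → ℝ≥0∞ := fun h =>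
    (S ×ˢ S).indicator fun p => if dist p.1 p.2 ∈ Set.Ioc h (2 * h) then
      ENNReal.ofReal ((u p.1 - u p.2) ^ 2 / dist p.1 p.2 ^ 4) else 0 with hF
  have hFm : ∀ h, Measurable (F h) := fun h => by
    refine Measurable.indicator (Measurable.ite ?_ (by fun_prop) measurable_const) (hSm.prod hSm)
    exact (measurable_fst.dist measurable_snd) measurableSet_Ioc
  have hE : ∀ h, annularEnergy u S h = ∫⁻ x, ∫⁻ y, F h (x, y) := fun h => by
    rw [annularEnergy, ← lintegral_indicator (hSm.prod hSm), lintegral_prod _ (hFm h).aemeasurable]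
  have hpt : ∀ x y, F h (x, y) ≤ ENNReal.ofReal (1 / 8) *
      (F (h / 2) (x, midpoint ℝ x y) + F (h / 2) (y, midpoint ℝ y x)) := by
    intro x y
    by_cases hxy : (x, y) ∈ S ×ˢ S
    swap
    · simp [hF, Set.indicator_of_notMem hxy]
    by_cases hd : dist x y ∈ Set.Ioc h (2 * h)
    swap
    · have : F h (x, y) = 0 := by
        simp only [hF, Set.indicator_of_mem hxy, if_neg hd]
      simp [this]
    have hm : midpoint ℝ x y ∈ S := hS.midpoint_mem hxy.1 hxy.2
    have d1 : dist x (midpoint ℝ x y) = dist x y / 2 := by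
      rw [dist_left_midpoint]; norm_num; ring
    have d2 : dist y (midpoint ℝ x y) = dist x y / 2 := by
      rw [dist_right_midpoint]; norm_num; ring
    have hd1 : dist x y / 2 ∈ Set.Ioc (h / 2) (2 * (h / 2)) := by
      constructor <;> linarith [hd.1, hd.2]
    have hpos : 0 < dist x y := hh.trans hd.1
    rw [midpoint_comm (R := ℝ) y x]
    simp only [hF, Set.indicator_of_mem hxy, Set.indicator_of_mem (Set.mk_mem_prod hxy.1 hm),
      Set.indicator_of_mem (Set.mk_mem_prod hxy.2 hm), d1, d2, if_pos hd, if_pos hd1]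
    rw [← ENNReal.ofReal_add (by positivity) (by positivity), ← ENNReal.ofReal_mul (by norm_num)]
    apply ENNReal.ofReal_le_ofReal
    set m := u (midpoint ℝ x y)
    rw [← add_div, div_pow, div_div_eq_mul_div, ← mul_div_assoc]
    gcongr
    nlinarith [sq_nonneg (u x + u y - 2 * m)]
  have hI : ∫⁻ x, ∫⁻ y, F (h / 2) (x, midpoint ℝ x y) = 4 * annularEnergy u S (h / 2) := by
    rw [hE, ← lintegral_const_mul _ (hFm _).lintegral_prod_right']
    congr 1 with x
    exact lintegral_comp_midpoint ((hFm (h / 2)).comp measurable_prodMk_left) x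
  have hmm : Measurable fun p : EuclideanSpace ℝ (Fin 2) × EuclideanSpace ℝ (Fin 2) =>
      F (h / 2) (p.1, midpoint ℝ p.1 p.2) := by
    have : Measurable fun p : EuclideanSpace ℝ (Fin 2) × EuclideanSpace ℝ (Fin 2) =>
        midpoint ℝ p.1 p.2 := by
      simp_rw [midpoint_eq_smul_add]; fun_prop
    exact (hFm (h / 2)).comp (measurable_fst.prodMk this)
  have hmm' : Measurable fun p : EuclideanSpace ℝ (Fin 2) × EuclideanSpace ℝ (Fin 2) =>
      F (h / 2) (p.2, midpoint ℝ p.2 p.1) := hmm.comp measurable_swap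
  have hJ : ∫⁻ x, ∫⁻ y, F (h / 2) (y, midpoint ℝ y x) = 4 * annularEnergy u S (h / 2) := by
    rw [lintegral_lintegral_swap hmm'.aemeasurable, hI]
  calc annularEnergy u S h = ∫⁻ x, ∫⁻ y, F h (x, y) := hE h
    _ ≤ ∫⁻ x, ∫⁻ y, ENNReal.ofReal (1 / 8) *
      (F (h / 2) (x, midpoint ℝ x y) + F (h / 2) (y, midpoint ℝ y x)) := by
      gcongr with x y; exact hpt x y
    _ = ENNReal.ofReal (1 / 8) * ((∫⁻ x, ∫⁻ y, F (h / 2) (x, midpoint ℝ x y)) +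
        ∫⁻ x, ∫⁻ y, F (h / 2) (y, midpoint ℝ y x)) := by
      have hA1 : Measurable fun x => ∫⁻ y, F (h / 2) (x, midpoint ℝ x y) :=
        hmm.lintegral_prod_right'
      have hA2 : Measurable fun x => ∫⁻ y, F (h / 2) (y, midpoint ℝ y x) :=
        hmm'.lintegral_prod_right'
      have hA : Measurable fun x => (∫⁻ y, F (h / 2) (x, midpoint ℝ x y)) +
          ∫⁻ y, F (h / 2) (y, midpoint ℝ y x) := hA1.add hA2
      rw [← lintegral_add_left hA1, ← lintegral_const_mul _ hA]
      congr 1 with x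
      have hB1 : Measurable fun y => F (h / 2) (x, midpoint ℝ x y) :=
        hmm.comp measurable_prodMk_left
      have hB2 : Measurable fun y => F (h / 2) (y, midpoint ℝ y x) :=
        hmm'.comp measurable_prodMk_left
      have hB : Measurable fun y => F (h / 2) (x, midpoint ℝ x y) + F (h / 2) (y, midpoint ℝ y x) :=
        hB1.add hB2
      rw [← lintegral_add_left hB1, ← lintegral_const_mul _ hB]
    _ = annularEnergy u S (h / 2) := by
      rw [hI, hJ, ← two_mul, ← mul_assoc, ← mul_assoc]
      have : ENNReal.ofReal (1 / 8) * 2 * 4 = 1 := by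
        rw [show (2 : ℝ≥0∞) = ENNReal.ofReal 2 by simp, show (4 : ℝ≥0∞) = ENNReal.ofReal 4 by simp,
          ← ENNReal.ofReal_mul (by norm_num), ← ENNReal.ofReal_mul (by norm_num)]
        norm_num
      rw [this, one_mul]

/-- For a nondecreasing sequence, geometrically weighted sums of different ratios compare. -/
theorem tsum_pow_mul_le_of_monotone {e : ℕ → ℝ≥0∞} (he : Monotone e) {p q : ℝ} (hp : 0 < p)
    (hpq : p < q) (hq : q < 1) :
    ∑' n, ENNReal.ofReal (p ^ n) * e n ≤
      ENNReal.ofReal ((1 - q) / (1 - p / q)) * ∑' n, ENNReal.ofReal (q ^ n) * e n := by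
  have hq0 : 0 < q := hp.trans hpq
  have hlt : p / q < 1 := (div_lt_one hq0).2 hpq
  have geo : ∀ {t : ℝ}, 0 ≤ t → t < 1 → ∑' n : ℕ, ENNReal.ofReal (t ^ n) = ENNReal.ofReal (1 / (1 - t)) := by
    intro t ht ht1
    rw [← ENNReal.ofReal_tsum_of_nonneg (fun n => by positivity)
      (summable_geometric_of_lt_one ht ht1), tsum_geometric_of_lt_one ht ht1, one_div]
  -- Insert `1 = (1 - q) * ∑ q ^ j`, write `p ^ n * q ^ j = (p / q) ^ n * q ^ (n + j)`, and use `e n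
  -- ≤ e (n + j)`; the shifted sum is at most the full one.
  have h1 : ∀ n, ENNReal.ofReal (p ^ n) * e n ≤ ENNReal.ofReal (1 - q) *
      (ENNReal.ofReal ((p / q) ^ n) * ∑' j, ENNReal.ofReal (q ^ j) * e j) := by
    intro n
    have h2 : ENNReal.ofReal (1 - q) * ∑' j : ℕ, ENNReal.ofReal (q ^ j) = 1 := by
      rw [geo hq0.le hq, ← ENNReal.ofReal_mul (by linarith), mul_one_div_cancel (by linarith)]
      simp
    calc ENNReal.ofReal (p ^ n) * e n
        = ENNReal.ofReal (p ^ n) * ((ENNReal.ofReal (1 - q) * ∑' j : ℕ, ENNReal.ofReal (q ^ j)) * e n) := by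
          rw [h2, one_mul]
      _ = ENNReal.ofReal (1 - q) * (ENNReal.ofReal ((p / q) ^ n) *
          ∑' j, ENNReal.ofReal (q ^ (n + j)) * e n) := by
          have : ∀ j, ENNReal.ofReal (q ^ (n + j)) * e n =
              ENNReal.ofReal (q ^ n) * (ENNReal.ofReal (q ^ j) * e n) := fun j => by
            rw [pow_add, ENNReal.ofReal_mul (by positivity), mul_assoc]
          simp_rw [this]
          rw [ENNReal.tsum_mul_left, ENNReal.tsum_mul_right, ← mul_assoc (ENNReal.ofReal ((p / q) ^ n)),
            ← ENNReal.ofReal_mul (by positivity), ← mul_pow, div_mul_cancel₀ _ hq0.ne']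
          ring
      _ ≤ ENNReal.ofReal (1 - q) * (ENNReal.ofReal ((p / q) ^ n) *
          ∑' j, ENNReal.ofReal (q ^ (n + j)) * e (n + j)) := by
          gcongr with j
          exact he (Nat.le_add_right n j)
      _ ≤ _ := by
          refine mul_le_mul' le_rfl (mul_le_mul' le_rfl ?_)
          exact ENNReal.tsum_comp_le_tsum_of_injective (add_right_injective n)
            (fun j => ENNReal.ofReal (q ^ j) * e j)
  calc _ ≤ _ := ENNReal.tsum_le_tsum h1
    _ = _ := by
      rw [ENNReal.tsum_mul_left, ENNReal.tsum_mul_right, geo (by positivity) hlt, ← mul_assoc,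
        ← ENNReal.ofReal_mul (by linarith), mul_one_div]

theorem ofReal_one_div_rpow_mul_enorm_sq {d : ℝ} (hd : 0 < d) (s a : ℝ) :
    ENNReal.ofReal (1 / d ^ (2 * s + 2)) * ‖a‖ₑ ^ 2 =
      ENNReal.ofReal (d ^ (2 - 2 * s)) * ENNReal.ofReal (a ^ 2 / d ^ 4) := by
  rw [Real.enorm_eq_ofReal_abs, ← ENNReal.ofReal_pow (abs_nonneg _), sq_abs,
    ← ENNReal.ofReal_mul (by positivity), ← ENNReal.ofReal_mul (by positivity)]
  congr 1
  have h4 : d ^ 4 = d ^ (2 - 2 * s) * d ^ (2 * s + 2) := by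
    rw [← Real.rpow_add hd, show 2 - 2 * s + (2 * s + 2) = (4 : ℕ) by push_cast; ring,
      Real.rpow_natCast]
  rw [h4]
  have := Real.rpow_pos_of_pos hd (2 - 2 * s)
  have := Real.rpow_pos_of_pos hd (2 * s + 2)
  field_simp

theorem measurable_annular {u : EuclideanSpace ℝ (Fin 2) → ℝ} (hu : Continuous u) (h : ℝ) :
    Measurable fun p : EuclideanSpace ℝ (Fin 2) × EuclideanSpace ℝ (Fin 2) =>
      if dist p.1 p.2 ∈ Set.Ioc h (2 * h) then
        ENNReal.ofReal ((u p.1 - u p.2) ^ 2 / dist p.1 p.2 ^ 4) else 0 :=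
  Measurable.ite ((measurable_fst.dist measurable_snd) measurableSet_Ioc) (by fun_prop)
    measurable_const

/-- Pairs of distinct points of the disk are at distance below `2 * r`, so each falls in a dyadic
shell; there `d ^ (2 - 2 * s)` is bounded by its value at the outer radius. The reverse estimate
below uses the inner radius. -/
theorem setLIntegral_le_tsum_annularEnergy {u : EuclideanSpace ℝ (Fin 2) → ℝ} (hu : Continuous u)
    {x₀ : EuclideanSpace ℝ (Fin 2)} {r s : ℝ} (hr : 0 < r) (hs : s < 1) :
    ∫⁻ p in ball x₀ r ×ˢ ball x₀ r, ENNReal.ofReal (1 / dist p.1 p.2 ^ (2 * s + 2)) *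
        ‖u p.1 - u p.2‖ₑ ^ 2 ∂(volume.prod volume) ≤
      ∑' k : ℕ, ENNReal.ofReal ((2 * (r * (1 / 2) ^ k)) ^ (2 - 2 * s)) *
        annularEnergy u (ball x₀ r) (r * (1 / 2) ^ k) := by
  simp_rw [annularEnergy, ← lintegral_const_mul _ (measurable_annular hu _)]
  rw [← lintegral_tsum fun k => ((measurable_annular hu _).const_mul _).aemeasurable]
  refine setLIntegral_mono' (measurableSet_ball.prod measurableSet_ball) fun p hp => ?_
  rcases eq_or_ne p.1 p.2 with h | h
  · simp [h]
  have hd : 0 < dist p.1 p.2 := dist_pos.2 h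
  have hd2 : dist p.1 p.2 < 2 * r := by
    linarith [dist_triangle_right p.1 p.2 x₀, mem_ball.1 hp.1, mem_ball.1 hp.2]
  obtain ⟨k, hk, hk'⟩ := exists_nat_pow_near_of_lt_one (x := dist p.1 p.2 / (2 * r)) (y := 1 / 2)
    (by positivity) ((div_le_one (by positivity)).2 hd2.le) (by norm_num) (by norm_num)
  rw [lt_div_iff₀ (by positivity)] at hk
  rw [div_le_iff₀ (by positivity)] at hk'
  rw [pow_succ] at hk
  have hmem : dist p.1 p.2 ∈ Set.Ioc (r * (1 / 2) ^ k) (2 * (r * (1 / 2) ^ k)) :=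
    ⟨by linarith, by linarith⟩
  refine le_trans ?_ (ENNReal.le_tsum k)
  rw [if_pos hmem, ofReal_one_div_rpow_mul_enorm_sq hd]
  exact mul_le_mul' (ENNReal.ofReal_le_ofReal
    (Real.rpow_le_rpow hd.le hmem.2 (by linarith))) le_rfl

theorem tsum_annularEnergy_le_setLIntegral {u : EuclideanSpace ℝ (Fin 2) → ℝ} (hu : Continuous u)
    {x₀ : EuclideanSpace ℝ (Fin 2)} {r s : ℝ} (hr : 0 < r) (hs : s < 1) :
    ∑' k : ℕ, ENNReal.ofReal ((r * (1 / 2) ^ k) ^ (2 - 2 * s)) *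
        annularEnergy u (ball x₀ r) (r * (1 / 2) ^ k) ≤
    ∫⁻ p in ball x₀ r ×ˢ ball x₀ r, ENNReal.ofReal (1 / dist p.1 p.2 ^ (2 * s + 2)) *
        ‖u p.1 - u p.2‖ₑ ^ 2 ∂(volume.prod volume) := by
  simp_rw [annularEnergy, ← lintegral_const_mul _ (measurable_annular hu _)]
  rw [← lintegral_tsum fun k => ((measurable_annular hu _).const_mul _).aemeasurable]
  refine lintegral_mono fun p => ?_
  by_cases hex : ∃ k : ℕ, dist p.1 p.2 ∈ Set.Ioc (r * (1 / 2) ^ k) (2 * (r * (1 / 2) ^ k))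
  · obtain ⟨k, hk⟩ := hex
    have hrk : 0 < r * (1 / 2) ^ k := by positivity
    rw [tsum_eq_single k]
    · rw [if_pos hk, ofReal_one_div_rpow_mul_enorm_sq (hrk.trans hk.1)]
      refine mul_le_mul' (ENNReal.ofReal_le_ofReal ?_) le_rfl
      exact Real.rpow_le_rpow hrk.le hk.1.le (by linarith)
    · intro j hj
      rw [if_neg, mul_zero]
      have hstep : ∀ i l : ℕ, i < l → 2 * (r * (1 / 2) ^ l) ≤ r * (1 / 2) ^ i := fun i l hil => by
        have : (1 / 2 : ℝ) ^ l ≤ (1 / 2) ^ (i + 1) :=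
          pow_le_pow_of_le_one (by norm_num) (by norm_num) hil
        rw [pow_succ] at this
        nlinarith
      intro hj'
      rcases lt_or_gt_of_ne hj with h | h
      · linarith [hstep _ _ h, hj'.1, hk.2]
      · linarith [hstep _ _ h, hj'.2, hk.1]
  · push Not at hex
    simp only [if_neg (hex _), mul_zero, tsum_zero, zero_le]

/-- Near `s = 1` the energy controls a lower order one with a factor `1 - s`. -/
theorem setLIntegral_three_quarters_le {u : EuclideanSpace ℝ (Fin 2) → ℝ} (hu : Continuous u)
    {x₀ : EuclideanSpace ℝ (Fin 2)} {r s : ℝ} (hr : 0 < r) (hs : 7 / 8 ≤ s) (hs' : s < 1) :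
    ∫⁻ p in ball x₀ r ×ˢ ball x₀ r, ENNReal.ofReal (1 / dist p.1 p.2 ^ (2 * (3 / 4 : ℝ) + 2)) *
        ‖u p.1 - u p.2‖ₑ ^ 2 ∂(volume.prod volume) ≤
    ENNReal.ofReal (32 * (1 - s) * r ^ (2 * s - 3 / 2)) *
      ∫⁻ p in ball x₀ r ×ˢ ball x₀ r, ENNReal.ofReal (1 / dist p.1 p.2 ^ (2 * s + 2)) *
        ‖u p.1 - u p.2‖ₑ ^ 2 ∂(volume.prod volume) := by
  set e : ℕ → ℝ≥0∞ := fun k => annularEnergy u (ball x₀ r) (r * (1 / 2) ^ k) with he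
  have hmono : Monotone e := monotone_nat_of_le_succ fun k => by
    have := annularEnergy_le_half hu (convex_ball x₀ r) measurableSet_ball
      (h := r * (1 / 2) ^ k) (by positivity)
    simp only [he]
    rwa [pow_succ, ← mul_assoc, mul_one_div]
  set p : ℝ := (1 / 2) ^ (1 / 2 : ℝ) with hp
  set q : ℝ := (1 / 2) ^ (2 - 2 * s) with hq
  have hp0 : 0 < p := by positivity
  have hq0 : 0 < q := by positivity
  have hpq : p < q := Real.rpow_lt_rpow_of_exponent_gt (by norm_num) (by norm_num) (by linarith)
  have hq1 : q < 1 := Real.rpow_lt_one (by norm_num) (by norm_num) (by linarith)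
  have hpow : ∀ (t : ℝ) (k : ℕ), (((1 / 2 : ℝ)) ^ k) ^ t = ((1 / 2) ^ t) ^ k := fun t k => by
    rw [← Real.rpow_natCast_mul (by norm_num), mul_comm, Real.rpow_mul_natCast (by norm_num)]
  -- `1 - q ≤ 2 * (1 - s)` follows from `exp x ≥ 1 + x` and `log 2 < 1`. For `s ≥ 7/8` the ratio `p
  -- / q` is at most `(1/2) ^ (1/4) ≤ 7/8`, since `(7/8) ^ 4 ≥ 1/2`.
  have hc : (1 - q) / (1 - p / q) ≤ 16 * (1 - s) := by
    have h1 : 1 - q ≤ 2 * (1 - s) := by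
      have h := Real.add_one_le_exp (Real.log (1 / 2) * (2 - 2 * s))
      rw [← Real.rpow_def_of_pos (by norm_num)] at h
      have hl : Real.log (1 / 2) = - Real.log 2 := by rw [one_div, Real.log_inv]
      have hl2 := Real.log_two_lt_d9
      rw [hl] at h
      have : Real.log 2 * (2 - 2 * s) ≤ 1 * (2 - 2 * s) := by gcongr <;> linarith
      linarith
    have h2 : p / q ≤ 7 / 8 := by
      rw [hp, hq, ← Real.rpow_sub (by norm_num)]
      calc (1 / 2 : ℝ) ^ (1 / 2 - (2 - 2 * s)) ≤ (1 / 2) ^ (1 / 4 : ℝ) :=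
            Real.rpow_le_rpow_of_exponent_ge (by norm_num) (by norm_num) (by linarith)
        _ ≤ ((7 / 8 : ℝ) ^ (4 : ℝ)) ^ (1 / 4 : ℝ) :=
            Real.rpow_le_rpow (by norm_num) (by norm_num) (by norm_num)
        _ = 7 / 8 := by rw [← Real.rpow_mul (by norm_num)]; norm_num
    rw [div_le_iff₀ (by linarith)]
    nlinarith
  have hr' : (2 * r) ^ (1 / 2 : ℝ) * (r ^ (2 - 2 * s))⁻¹ ≤ 2 * r ^ (2 * s - 3 / 2) := by
    rw [Real.mul_rpow (by norm_num) hr.le, mul_assoc, ← Real.rpow_neg hr.le, ← Real.rpow_add hr]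
    rw [show 1 / 2 + -(2 - 2 * s) = 2 * s - 3 / 2 by ring]
    gcongr
    calc (2 : ℝ) ^ (1 / 2 : ℝ) ≤ 2 ^ (1 : ℝ) :=
          Real.rpow_le_rpow_of_exponent_le (by norm_num) (by norm_num)
      _ = 2 := Real.rpow_one 2
  set E := ∫⁻ p in ball x₀ r ×ˢ ball x₀ r, ENNReal.ofReal (1 / dist p.1 p.2 ^ (2 * s + 2)) *
        ‖u p.1 - u p.2‖ₑ ^ 2 ∂(volume.prod volume)
  have hlow : ∑' k, ENNReal.ofReal (q ^ k) * e k ≤ ENNReal.ofReal ((r ^ (2 - 2 * s))⁻¹) * E := by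
    refine le_trans (le_of_eq ?_) (mul_le_mul' le_rfl
      (tsum_annularEnergy_le_setLIntegral hu (x₀ := x₀) hr hs'))
    rw [← ENNReal.tsum_mul_left]
    congr 1 with k
    rw [← mul_assoc, ← ENNReal.ofReal_mul (by positivity), Real.mul_rpow hr.le (by positivity),
      hpow, inv_mul_cancel_left₀ (by positivity)]
  calc _ ≤ ∑' k : ℕ, ENNReal.ofReal ((2 * (r * (1 / 2) ^ k)) ^ (2 - 2 * (3 / 4 : ℝ))) * e k :=
        setLIntegral_le_tsum_annularEnergy hu hr (by norm_num)
    _ = ENNReal.ofReal ((2 * r) ^ (1 / 2 : ℝ)) * ∑' k, ENNReal.ofReal (p ^ k) * e k := by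
        rw [← ENNReal.tsum_mul_left]
        congr 1 with k
        rw [show (2 : ℝ) - 2 * (3 / 4) = 1 / 2 by norm_num, ← mul_assoc 2 r,
          Real.mul_rpow (by positivity) (by positivity), hpow, ENNReal.ofReal_mul (by positivity),
          mul_assoc]
    _ ≤ ENNReal.ofReal ((2 * r) ^ (1 / 2 : ℝ)) * (ENNReal.ofReal (16 * (1 - s)) *
        (ENNReal.ofReal ((r ^ (2 - 2 * s))⁻¹) * E)) := by
        refine mul_le_mul' le_rfl ((tsum_pow_mul_le_of_monotone hmono hp0 hpq hq1).trans ?_)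
        exact mul_le_mul' (ENNReal.ofReal_le_ofReal hc) hlow
    _ = ENNReal.ofReal (16 * (1 - s) * ((2 * r) ^ (1 / 2 : ℝ) * (r ^ (2 - 2 * s))⁻¹)) * E := by
        have : 0 < 1 - s := by linarith
        rw [ENNReal.ofReal_mul (p := 16 * (1 - s)) (by positivity),
          ENNReal.ofReal_mul (p := (2 * r) ^ (1 / 2 : ℝ)) (by positivity)]
        ring
    _ ≤ _ := by
        refine mul_le_mul' (ENNReal.ofReal_le_ofReal ?_) le_rfl
        have : 0 < 1 - s := by linarith
        nlinarith [mul_le_mul_of_nonneg_left hr' (by positivity : 0 ≤ 16 * (1 - s))]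

/-! ### Two-sided sharp order of the constant and conclusion. -/

/-- Fractional Poincaré inequality with a constant of the sharp order as `s ↘ 1 / 2` and
`s ↗ 1`. -/
theorem setLIntegral_enorm_sq_le_sharp {u : EuclideanSpace ℝ (Fin 2) → ℝ}
    (hu : Continuous u) {x₀ : EuclideanSpace ℝ (Fin 2)} {r s : ℝ} (hr : 0 < r)
    (hs : 1 / 2 < s) (hs' : s < 1) (h0 : ∀ ρ, 0 < ρ → ∃ y, dist y x₀ = ρ ∧ u y = 0) :
    ∫⁻ x in ball x₀ r, ‖u x‖ₑ ^ 2 ≤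
      ENNReal.ofReal (2 ^ 19 * ((1 - s) / (s - 1 / 2)) * r ^ (2 * s)) *
      ∫⁻ p in ball x₀ r ×ˢ ball x₀ r, ENNReal.ofReal (1 / dist p.1 p.2 ^ (2 * s + 2)) *
          ‖u p.1 - u p.2‖ₑ ^ 2 ∂(volume.prod volume) := by
  have h1 : 0 < 1 - s := by linarith
  have h2 : 0 < s - 1 / 2 := by linarith
  -- Below `7/8`, `1 - s > 1/8` and the factor `1 - s` is absorbed in the constant. Above it, the
  -- order `3/4` inequality has constant `4096 / (1/4) = 2 ^ 14`, and the comparison of energies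
  -- contributes `32 = 2 ^ 5`.
  rcases lt_or_ge s (7 / 8) with h | h
  · refine (setLIntegral_enorm_sq_le_of_exists_zero hu hr hs hs' h0).trans ?_
    refine mul_le_mul' (ENNReal.ofReal_le_ofReal ?_) le_rfl
    gcongr
    rw [← mul_div_assoc]
    gcongr
    linarith
  · refine (setLIntegral_enorm_sq_le_of_exists_zero hu (s := 3 / 4) hr (by norm_num) (by norm_num)
      h0).trans ?_
    refine (mul_le_mul' le_rfl (setLIntegral_three_quarters_le hu hr h hs')).trans ?_
    rw [← mul_assoc, ← ENNReal.ofReal_mul (by positivity)]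
    refine mul_le_mul' (ENNReal.ofReal_le_ofReal ?_) le_rfl
    have hrr : r ^ (2 * (3 / 4 : ℝ)) * r ^ (2 * s - 3 / 2) = r ^ (2 * s) := by
      rw [← Real.rpow_add hr]; congr 1; ring
    calc _ = 2 ^ 19 * (1 - s) * (r ^ (2 * (3 / 4 : ℝ)) * r ^ (2 * s - 3 / 2)) := by ring
      _ ≤ _ := by
        rw [hrr]
        gcongr
        rw [le_div_iff₀ h2]
        nlinarith

theorem proposition3p1 :
    ∃ T : ℝ → ℝ,
      (∀ s : ℝ, 1 / 2 < s → s < 1 → 0 < T s ∧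
        ∀ Ω : Set (EuclideanSpace ℝ (Fin 2)), IsOpen Ω → IsSimplyConnected Ω →
          ∀ r : ℝ, 0 < r → ∀ x₀ ∈ frontier Ω,
            ∀ u : EuclideanSpace ℝ (Fin 2) → ℝ,
              ContDiff ℝ ∞ u → HasCompactSupport u → tsupport u ⊆ Ω →
                ENNReal.ofReal (T s / r ^ (2 * s)) *
                    ∫⁻ x in ball x₀ r, ENNReal.ofReal (|u x| ^ 2)
                  ≤ gagliardoEnergy s u (ball x₀ r) Set.univ) ∧
      (∃ a : ℝ, 0 < a ∧ Tendsto (fun s : ℝ => T s / (s - 1 / 2)) (𝓝[>] (1 / 2)) (𝓝 a)) ∧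
      (∃ b : ℝ, 0 < b ∧ Tendsto (fun s : ℝ => T s / (1 / (1 - s))) (𝓝[<] 1) (𝓝 b)) := by
  -- The reciprocal of the constant in `setLIntegral_enorm_sq_le_sharp` without the power of `r`;
  -- its limits come from `1 / (1 - s) → 2` and `s - 1/2 → 1/2`.
  refine ⟨fun s => (s - 1 / 2) / (1 - s) / 2 ^ 19, ?_, ⟨2 / 2 ^ 19, by norm_num, ?_⟩,
    ⟨1 / 2 / 2 ^ 19, by norm_num, ?_⟩⟩
  · intro s hs hs'
    have h1 : 0 < 1 - s := by linarith
    have h2 : 0 < s - 1 / 2 := by linarith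
    refine ⟨by positivity, fun Ω hΩ hsc r hr x₀ hx₀ u hu _ hsupp => ?_⟩
    have hx₀' : x₀ ∉ Ω := by
      rw [frontier, hΩ.interior_eq] at hx₀
      exact hx₀.2
    have h0 : ∀ ρ, 0 < ρ → ∃ y, dist y x₀ = ρ ∧ u y = 0 := fun ρ hρ => by
      obtain ⟨y, hy, hyΩ⟩ := exists_dist_eq_notMem_of_isSimplyConnected hΩ hsc hx₀' hρ
      exact ⟨y, hy, image_eq_zero_of_notMem_tsupport fun h => hyΩ (hsupp h)⟩
    have key := setLIntegral_enorm_sq_le_sharp hu.continuous hr hs hs' h0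
    have hrs := Real.rpow_pos_of_pos hr (2 * s)
    have hsq : ∀ a : ℝ, ENNReal.ofReal (|a| ^ 2) = ‖a‖ₑ ^ 2 := fun a => by
      rw [Real.enorm_eq_ofReal_abs, ENNReal.ofReal_pow (abs_nonneg a)]
    simp_rw [hsq]
    refine (mul_le_mul' le_rfl key).trans ?_
    rw [← mul_assoc, ← ENNReal.ofReal_mul (by positivity)]
    have hone : (s - 1 / 2) / (1 - s) / 2 ^ 19 / r ^ (2 * s) *
        (2 ^ 19 * ((1 - s) / (s - 1 / 2)) * r ^ (2 * s)) = 1 := by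
      generalize s - 1 / 2 = a at h2
      field_simp
    rw [hone, ENNReal.ofReal_one, one_mul, gagliardoEnergy]
    -- Only pairs with both points in the disk are used; enlarging the second factor to the plane
    -- increases the energy.
    refine le_trans (le_of_eq ?_)
      (lintegral_mono_set (Set.prod_mono_right (Set.subset_univ (ball x₀ r))))
    refine lintegral_congr fun p => ?_
    rw [← hsq, ← ENNReal.ofReal_mul (by positivity), dist_eq_norm, add_comm (2 * s)]
    congr 1
    ring
  · have hc : ContinuousAt (fun s : ℝ => 1 / (1 - s) / 2 ^ 19) (1 / 2) :=
      (continuousAt_const.div (by fun_prop) (by norm_num)).div_const _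
    have ht := hc.tendsto.mono_left (nhdsWithin_le_nhds (s := Set.Ioi (1 / 2)))
    rw [show (2 : ℝ) / 2 ^ 19 = 1 / (1 - 1 / 2) / 2 ^ 19 by norm_num]
    refine ht.congr' ?_
    filter_upwards [self_mem_nhdsWithin] with s hs
    have h : s - 1 / 2 ≠ 0 := (sub_pos.2 hs).ne'
    generalize s - 1 / 2 = a at h
    field_simp
  · have hc : ContinuousAt (fun s : ℝ => (s - 1 / 2) / 2 ^ 19) 1 := by fun_prop
    have ht := hc.tendsto.mono_left (nhdsWithin_le_nhds (s := Set.Iio 1))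
    norm_num at ht ⊢
    refine ht.congr' ?_
    filter_upwards [self_mem_nhdsWithin] with s hs
    have : 1 - s ≠ 0 := (sub_pos.2 hs).ne'
    field_simp
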